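/- Let $n\ge 2$. Let $\mathcal M\subset\mathbb R^n$ be a discrete $n$-manifold, i.e. a finite simplicial complex that is a union of $n$-simplices and whose underlying space is homeomorphic to the closed unit ball $\mathbb B^n$ of $\mathbb R^n$. Let $\mathbb S_0(\mathcal M)=\{v_1,\dots,v_N\}$ be its set of vertices, $\mathbb S_1(\mathcal M)$ its set of edges and $\mathbb S_n(\mathcal M)=\{\sigma_1,\dots,\sigma_m\}$ its set of $n$-simplices. Write $|\cdot|$ for the $k$-dimensional Euclidean volume of a $k$-simplex. Let $\rho$ be a density on $\mathcal M$ with a constant value $\rho(\sigma)>0$ on each $\sigma\in\mathbb S_n(\mathcal M)$, and put $\mu(\sigma)=\rho(\sigma)|\sigma|$. A vertex $v$ is a boundary vertex if its link (the union of the $(n-1)$-simplices $\tau$ with $v\notin\tau$ such that $[v,\tau]$ is an $n$-simplex of $\mathcal M$) is not homeomorphic to the sphere $\mathbb S^{n-1}$. Let $f:\mathcal M\to\mathbb B^n$ be piecewise affine (affine on each simplex of $\mathcal M$) and orientation preserving (on each $n$-simplex the linear part of $f$ has positive determinant), with $f(\partial\mathcal M)=\mathbb S^{n-1}$ in the discrete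 sense that $f$ maps every boundary vertex to the unit sphere $\mathbb S^{n-1}$, and with $\sum_{\sigma\in\mathbb S_n(\mathcal M)}|f(\sigma)|=C$. Let $\mathbf f\in\mathbb R^{N\times n}$ be the matrix with rows $\mathbf f_i=f(v_i)$, and define the discrete volumetric stretch energy $$E_V(f)=\frac1n\,\mathrm{trace}\big(\mathbf f^\top L_V(f)\,\mathbf f\big),\qquad [L_V(f)]_{ij}=\begin{cases}-w_{ij}(f),&[v_i,v_j]\in\mathbb S_1(\mathcal M),\\ \sum_{\ell\ne i}w_{i\ell}(f),& i=j,\\ 0,&\text{otherwise,}\end{cases}$$ $$w_{ij}(f)=\frac1{n(n-1)}\sum_{\sigma\in\mathbb S_n(\mathcal M):\ v_i,v_j\in\sigma}\frac{|f(\sigma_{\hat i\hat j})|}{\mu(\sigma)/|f(\sigma)|}\cot\theta^{\sigma}_{ij}(f),$$ where $\sigma_{\hat i\hat j}$ is the $(n-2)$-face of $\sigma$ with the vertices of $\sigma$ other than $v_i,v_j$ and $\theta^\sigma_{ij}(f)$ is the interior dihedral angle of $f(\sigma)$ between the facets opposite to $\mathbf f_i$ and $\mathbf f_j$. Put $$\varepsilon=E_V(f)-\frac{C^2}{\sum_{\sigma\in\mathbb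 S_n(\mathcal M)}\mu(\sigma)},\qquad \delta=(\delta_1,\dots,\delta_m),\quad \delta_i=\frac{|f(\sigma_i)|\big/\sum_{\sigma\in\mathbb S_n(\mathcal M)}|f(\sigma)|}{\mu(\sigma_i)\big/\sum_{\sigma\in\mathbb S_n(\mathcal M)}\mu(\sigma)}-1 .$$ Then $$\mu_{\min}\frac{C^2}{\big(\sum_{\sigma\in\mathbb S_n(\mathcal M)}\mu(\sigma)\big)^2}\|\delta\|_2^2\ \le\ \varepsilon\ \le\ \mu_{\max}\frac{C^2}{\big(\sum_{\sigma\in\mathbb S_n(\mathcal M)}\mu(\sigma)\big)^2}\|\delta\|_2^2,$$ where $\mu_{\min}$ and $\mu_{\max}$ are the minimum and the maximum of $\mu(\sigma)$ over $\sigma\in\mathbb S_n(\mathcal M)$. -/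

import Mathlib

open scoped MeasureTheory

noncomputable section

/-- The `k`-dimensional Euclidean volume `|f([v₀, …, v_k])|` of the image under `f` of the simplex
whose set of vertices is `τ` (for `f = id`: the volume of the simplex itself).  Here `μHE[k]` is the
`k`-dimensional Hausdorff measure normalized so as to be Lebesgue measure on `ℝᵏ`. -/
def imageVolume {n : ℕ} (k : ℕ) (f : EuclideanSpace ℝ (Fin n) → EuclideanSpace ℝ (Fin n))
    (τ : Finset (EuclideanSpace ℝ (Fin n))) : ℝ :=
  (μHE[k] (f '' convexHull ℝ (τ : Set (EuclideanSpace ℝ (Fin n))))).toReal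

open Classical in
/-- For vertices `a ≠ b` of the simplex `σ`: the component of `f a - f b` orthogonal to the
hyperplane `U_a` through the points `f v`, `v ∈ σ \ {a}`.  It is a normal vector of `U_a`
pointing to the side of `f(σ)`. -/
def inwardNormal {n : ℕ} (f : EuclideanSpace ℝ (Fin n) → EuclideanSpace ℝ (Fin n))
    (σ : Finset (EuclideanSpace ℝ (Fin n))) (a b : EuclideanSpace ℝ (Fin n)) :
    EuclideanSpace ℝ (Fin n) :=
  (vectorSpan ℝ (f '' ((σ.erase a : Finset (EuclideanSpace ℝ (Fin n))) :
    Set (EuclideanSpace ℝ (Fin n)))))ᗮ.starProjection (f a - f b)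

/-- The (interior) dihedral angle of `f(σ)` between the hyperplanes `U_a ⊇ f(σ \ {a})` and
`U_b ⊇ f(σ \ {b})`: the supplement of the angle between the two inward normals. -/
def dihedralAngle {n : ℕ} (f : EuclideanSpace ℝ (Fin n) → EuclideanSpace ℝ (Fin n))
    (σ : Finset (EuclideanSpace ℝ (Fin n))) (a b : EuclideanSpace ℝ (Fin n)) : ℝ :=
  Real.pi - InnerProductGeometry.angle (inwardNormal f σ a b) (inwardNormal f σ b a)

/-- A discrete `n`-manifold in `ℝⁿ`: a finite simplicial complex which is a union of `n`-simplices
and whose underlying space is homeomorphic to the closed unit ball of `ℝⁿ`. -/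
structure DiscreteManifold (n : ℕ) extends
    Geometry.SimplicialComplex ℝ (EuclideanSpace ℝ (Fin n)) where
  finite_faces : faces.Finite
  pure : ∀ s ∈ faces, ∃ t ∈ faces, s ⊆ t ∧ t.card = n + 1
  homeo_ball : Nonempty (toSimplicialComplex.space ≃ₜ
    Metric.closedBall (0 : EuclideanSpace ℝ (Fin n)) 1)

namespace DiscreteManifold

variable {n : ℕ} (M : DiscreteManifold n)

/-- The set of `n`-simplices, each given by its set of `n + 1` vertices. -/
def simplices : Finset (Finset (EuclideanSpace ℝ (Fin n))) :=
  M.finite_faces.toFinset.filter fun σ => σ.card = n + 1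

theorem simplices_nonempty : M.simplices.Nonempty := by
  obtain ⟨e⟩ := M.homeo_ball
  have hx := (e.symm ⟨0, by simp⟩).2
  obtain ⟨s, hs, -⟩ := Geometry.SimplicialComplex.mem_space_iff.1 hx
  obtain ⟨t, ht, -, hcard⟩ := M.pure s hs
  exact ⟨t, by simp [simplices, ht, hcard]⟩

/-- The finite set of vertices. -/
def vertexSet : Finset (EuclideanSpace ℝ (Fin n)) :=
  Set.Finite.toFinset (s := M.toSimplicialComplex.vertices)
    (M.finite_faces.preimage (Finset.singleton_injective.injOn))

open Classical in
/-- The link of a vertex `v`: the union of the `(n-1)`-simplices `τ` of the complex with `v ∉ τ`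
for which `[v, τ]` is an `n`-simplex of the complex. -/
def link (v : EuclideanSpace ℝ (Fin n)) : Set (EuclideanSpace ℝ (Fin n)) :=
  ⋃ τ ∈ {τ : Finset (EuclideanSpace ℝ (Fin n)) | τ.card = n ∧ v ∉ τ ∧ insert v τ ∈ M.faces},
    convexHull ℝ (τ : Set (EuclideanSpace ℝ (Fin n)))

/-- A vertex is a boundary vertex if its link is not homeomorphic to the sphere `S^{n-1}`. -/
def IsBoundaryVertex (v : EuclideanSpace ℝ (Fin n)) : Prop :=
  v ∈ M.vertexSet ∧
    ¬ Nonempty (M.link v ≃ₜ Metric.sphere (0 : EuclideanSpace ℝ (Fin n)) 1)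

/-- `f` is affine on every simplex of the complex. -/
def PiecewiseAffine (f : EuclideanSpace ℝ (Fin n) → EuclideanSpace ℝ (Fin n)) : Prop :=
  ∀ σ ∈ M.faces, ∃ A : EuclideanSpace ℝ (Fin n) →ᵃ[ℝ] EuclideanSpace ℝ (Fin n),
    Set.EqOn f A (convexHull ℝ (σ : Set (EuclideanSpace ℝ (Fin n))))

/-- On every `n`-simplex, `f` is an affine map with positive Jacobian determinant. -/
def OrientationPreserving (f : EuclideanSpace ℝ (Fin n) → EuclideanSpace ℝ (Fin n)) : Prop :=
  ∀ σ ∈ M.simplices, ∃ A : EuclideanSpace ℝ (Fin n) →ᵃ[ℝ] EuclideanSpace ℝ (Fin n),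
    Set.EqOn f A (convexHull ℝ (σ : Set (EuclideanSpace ℝ (Fin n)))) ∧
    0 < LinearMap.det A.linear

/-- The mass `μ(σ) = ρ(σ) |σ|` of an `n`-simplex for the piecewise constant density `ρ`. -/
def mass (ρ : Finset (EuclideanSpace ℝ (Fin n)) → ℝ)
    (σ : Finset (EuclideanSpace ℝ (Fin n))) : ℝ :=
  ρ σ * imageVolume n id σ

/-- The stretch factor `μ(σ) / |f(σ)|`. -/
def stretchFactor (ρ : Finset (EuclideanSpace ℝ (Fin n)) → ℝ)
    (f : EuclideanSpace ℝ (Fin n) → EuclideanSpace ℝ (Fin n))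
    (σ : Finset (EuclideanSpace ℝ (Fin n))) : ℝ :=
  mass ρ σ / imageVolume n f σ

open Classical in
/-- The modified cotangent weight `w_{ab}(f)`: the sum over all `n`-simplices containing `a` and `b`
of `|f(σ \ {a, b})| / (μ(σ) / |f(σ)|) * cot θ_{ab}`, divided by `n (n - 1)`; here `σ \ {a, b}` spans
the `(n-2)`-face of `σ` opposite to the edge `[a, b]`. -/
def weight (ρ : Finset (EuclideanSpace ℝ (Fin n)) → ℝ)
    (f : EuclideanSpace ℝ (Fin n) → EuclideanSpace ℝ (Fin n))
    (a b : EuclideanSpace ℝ (Fin n)) : ℝ :=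
  1 / ((n : ℝ) * ((n : ℝ) - 1)) *
    ∑ σ ∈ M.simplices.filter (fun σ => a ∈ σ ∧ b ∈ σ),
      imageVolume (n - 2) f ((σ.erase a).erase b) / stretchFactor ρ f σ *
        Real.cot (dihedralAngle f σ a b)

open Classical in
/-- The volumetric stretch Laplacian matrix `L_V(f)`. -/
def stretchLaplacian (ρ : Finset (EuclideanSpace ℝ (Fin n)) → ℝ)
    (f : EuclideanSpace ℝ (Fin n) → EuclideanSpace ℝ (Fin n)) :
    Matrix M.vertexSet M.vertexSet ℝ :=
  Matrix.of fun a b =>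
    if a = b then ∑ c ∈ Finset.univ.erase a, M.weight ρ f a c
    else if ({a.1, b.1} : Finset (EuclideanSpace ℝ (Fin n))) ∈ M.faces then - M.weight ρ f a b
    else 0

/-- The matrix whose rows are the images `f(v)` of the vertices `v`. -/
def vertexMatrix (f : EuclideanSpace ℝ (Fin n) → EuclideanSpace ℝ (Fin n)) :
    Matrix M.vertexSet (Fin n) ℝ :=
  Matrix.of fun v s => f v s

/-- The discrete `n`-dimensional volumetric stretch energy
`E_V(f) = (1/n) trace (𝐟ᵀ L_V(f) 𝐟)`. -/
def stretchEnergy (ρ : Finset (EuclideanSpace ℝ (Fin n)) → ℝ)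
    (f : EuclideanSpace ℝ (Fin n) → EuclideanSpace ℝ (Fin n)) : ℝ :=
  1 / (n : ℝ) *
    Matrix.trace ((M.vertexMatrix f).transpose * M.stretchLaplacian ρ f * M.vertexMatrix f)

/-- The total mass of the `n`-simplices. -/
def totalMass (ρ : Finset (EuclideanSpace ℝ (Fin n)) → ℝ) : ℝ :=
  ∑ σ ∈ M.simplices, mass ρ σ

/-- The smallest mass of an `n`-simplex. -/
def minMass (ρ : Finset (EuclideanSpace ℝ (Fin n)) → ℝ) : ℝ :=
  M.simplices.inf' M.simplices_nonempty (mass ρ)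

/-- The largest mass of an `n`-simplex. -/
def maxMass (ρ : Finset (EuclideanSpace ℝ (Fin n)) → ℝ) : ℝ :=
  M.simplices.sup' M.simplices_nonempty (mass ρ)

/-- The sum of the volumes of the images of the `n`-simplices. -/
def totalImageVolume (f : EuclideanSpace ℝ (Fin n) → EuclideanSpace ℝ (Fin n)) : ℝ :=
  ∑ σ ∈ M.simplices, imageVolume n f σ

/-- The vector `δ` of relative errors of the normalized volumes
`|f(σ)| / ∑ |f(σ')|` with respect to the normalized masses `μ(σ) / ∑ μ(σ')`. -/
def relativeError (ρ : Finset (EuclideanSpace ℝ (Fin n)) → ℝ)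
    (f : EuclideanSpace ℝ (Fin n) → EuclideanSpace ℝ (Fin n)) :
    EuclideanSpace ℝ M.simplices :=
  WithLp.toLp 2 fun σ =>
    (imageVolume n f σ / M.totalImageVolume f) / (mass ρ σ / M.totalMass ρ) - 1

end DiscreteManifold

end

/-! The energy collapses to `E_V(f) = ∑ |f(σ)|² / μ(σ)`. Given this, write `C = ∑ |f(σ)|` and `T = ∑
μ(σ)`. The weighted mean of the ratios `|f(σ)| / μ(σ)` with weights `μ(σ)` is `C / T`, so `ε` is
their weighted variance, and `ε = (C² / T²) ∑ μ(σ) δ_σ²` (`sum_sq_div_sub_sq_div`). Bounding each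
weight by the smallest and the largest mass gives both inequalities.

The closed form of the energy is a local statement. The Laplacian form is `1/2 ∑ w_ab ‖f a - f b‖²`
over ordered pairs, and each weight is a sum over simplices, so it suffices to evaluate `∑ |f(σ \
{a, b})| cot θ_ab ‖f a - f b‖²` on one simplex. Let `g_a` be the gradient of the barycentric
coordinate of `f a`, that is, the inward normal divided by its squared length. Applying the pyramid
volume formula twice gives `|f(σ \ {a, b})| cot θ_ab = -n(n-1) |f(σ)| ⟪g_a, g_b⟫`
(`hullVolume_mul_cot_dihedralAngle`). A trace computation gives `∑ ⟪g_a, g_b⟫ ‖f a - f b‖² = -2n`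
(`sum_inner_gradient_mul_norm_sub_sq`). The product is `2n²(n-1) |f(σ)|`, which the normalizations
of energy and weights reduce to `|f(σ)|`. -/

/-! ### Volumes of cones and pyramids -/

open Module in
/-- The Hausdorff measure of a cone with apex `0` over a subset of a hyperplane at distance `‖v‖`. -/
theorem euclideanHausdorffMeasure_cone {V : Type*} [NormedAddCommGroup V] [InnerProductSpace ℝ V]
    [FiniteDimensional ℝ V] [MeasurableSpace V] [BorelSpace V] {N : ℕ} (hV : finrank ℝ V = N + 1)
    {v : V} (hv : v ≠ 0) {T K : Set V} (hT : ∀ y ∈ T, inner ℝ v y = inner ℝ v v)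
    (hK : MeasurableSet K) (hKT : ∀ z, z ∈ K ↔ ∃ t ∈ Set.Icc (0 : ℝ) 1, ∃ y ∈ T, z = t • y) :
    μHE[N + 1] K = ‖v‖ₑ * (ENNReal.ofReal (1 / (N + 1)) * μHE[N] T) := by
  -- Cavalieri along the line `ℝ v`: the parameter `x` moves the hyperplane at speed `‖v‖`, whence
  -- the factor `‖v‖ₑ`. The base `T` lies in the slice `x = 1`.
  have h := EuclideanGeometry.euclideanHausdorffMeasure_eq_lintegral (0 : V) hv hK
  rw [hV] at h
  rw [h]
  congr 1
  have hvv : inner ℝ v v ≠ 0 := by simpa using hv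
  have hmem : ∀ (x : ℝ) (z : V), z ∈ AffineSubspace.mk' (x • v +ᵥ (0 : V)) (ℝ ∙ v)ᗮ ↔
      inner ℝ v z = x * inner ℝ v v := by
    intro x z
    rw [AffineSubspace.mem_mk', Submodule.mem_orthogonal_singleton_iff_inner_right]
    simp only [vadd_eq_add, add_zero, vsub_eq_sub, inner_sub_right, inner_smul_right]
    exact sub_eq_zero
  have hslice : ∀ x ∈ Set.Icc (0 : ℝ) 1,
      K ∩ AffineSubspace.mk' (x • v +ᵥ (0 : V)) (ℝ ∙ v)ᗮ = (fun y => x • y) '' T := by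
    intro x hx
    ext z
    simp only [Set.mem_inter_iff, SetLike.mem_coe, hmem, hKT, Set.mem_image]
    constructor
    · rintro ⟨⟨t, -, y, hy, rfl⟩, h2⟩
      rw [inner_smul_right, hT y hy] at h2
      exact ⟨y, hy, by rw [mul_right_cancel₀ hvv h2]⟩
    · rintro ⟨y, hy, rfl⟩
      exact ⟨⟨x, hx, y, hy, rfl⟩, by rw [inner_smul_right, hT y hy]⟩
  have hempty : ∀ x, x ∉ Set.Icc (0 : ℝ) 1 →
      K ∩ AffineSubspace.mk' (x • v +ᵥ (0 : V)) (ℝ ∙ v)ᗮ = ∅ := by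
    intro x hx
    rw [Set.eq_empty_iff_forall_notMem]
    rintro z ⟨h1, h2⟩
    obtain ⟨t, ht, y, hy, rfl⟩ := (hKT z).1 h1
    rw [SetLike.mem_coe, hmem, inner_smul_right, hT y hy] at h2
    exact hx (mul_right_cancel₀ hvv h2 ▸ ht)
  -- The slice at `x` is `x • T`, of measure `x ^ N` times that of `T`. The apex slice `x = 0` is
  -- discarded because the scaling rule needs a nonzero factor.
  have hint : ∀ᵐ x : ℝ, μHE[N + 1 - 1] (K ∩ AffineSubspace.mk' (x • v +ᵥ (0 : V)) (ℝ ∙ v)ᗮ) =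
      (Set.Ioc (0 : ℝ) 1).indicator (fun x => ENNReal.ofReal (x ^ N) * μHE[N] T) x := by
    have h0 : ∀ᵐ x : ℝ, x ≠ 0 := by simp [MeasureTheory.ae_iff]
    filter_upwards [h0] with x hx0
    by_cases hx : x ∈ Set.Icc (0 : ℝ) 1
    · have hpos : 0 < x := lt_of_le_of_ne hx.1 (Ne.symm hx0)
      rw [hslice x hx, Set.indicator_of_mem (Set.mem_Ioc.2 ⟨hpos, hx.2⟩),
        Set.image_smul, Nat.add_sub_cancel,
        MeasureTheory.Measure.euclideanHausdorffMeasure_smul₀ N hx0,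
        ENNReal.smul_def, smul_eq_mul]
      congr 1
      rw [ENNReal.ofReal_pow hpos.le, ENNReal.coe_pow]
      congr 1
      rw [← enorm_eq_nnnorm, Real.enorm_eq_ofReal hpos.le]
    · rw [hempty x hx, MeasureTheory.measure_empty, Set.indicator_of_notMem]
      exact fun h => hx ⟨h.1.le, h.2⟩
  rw [MeasureTheory.lintegral_congr_ae hint, MeasureTheory.lintegral_indicator measurableSet_Ioc,
    MeasureTheory.lintegral_mul_const _ (by fun_prop)]
  congr 1
  rw [← MeasureTheory.ofReal_integral_eq_lintegral_ofReal,
    ← intervalIntegral.integral_of_le zero_le_one, integral_pow]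
  · simp
  · exact ((continuous_pow N).integrableOn_Icc (a := (0 : ℝ)) (b := 1)).mono_set
      Set.Ioc_subset_Icc_self
  · filter_upwards [MeasureTheory.ae_restrict_mem measurableSet_Ioc] with x hx
    exact pow_nonneg hx.1.le N

open Module in
/-- The volume of a pyramid: height times volume of the base, divided by the dimension. -/
theorem euclideanHausdorffMeasure_convexHull_insert {V : Type*} [NormedAddCommGroup V]
    [InnerProductSpace ℝ V] [FiniteDimensional ℝ V] [MeasurableSpace V] [BorelSpace V] {N : ℕ}
    {S : Set V} (hS : S.Finite) {a s : V} (hs : s ∈ S)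
    (hrank : finrank ℝ (vectorSpan ℝ (insert a S)) = N + 1)
    (hd : (vectorSpan ℝ S)ᗮ.starProjection (a - s) ≠ 0) :
    (μHE[N + 1] (convexHull ℝ (insert a S))).toReal =
      ‖(vectorSpan ℝ S)ᗮ.starProjection (a - s)‖ / (N + 1) *
        (μHE[N] (convexHull ℝ S)).toReal := by
  set d := (vectorSpan ℝ S)ᗮ.starProjection (a - s) with hdef
  have hdperp : ∀ w ∈ vectorSpan ℝ S, inner ℝ d w = 0 := fun w hw =>
    Submodule.inner_left_of_mem_orthogonal hw (Submodule.starProjection_apply_mem _ _)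
  have hdiff : (a - s) - d ∈ vectorSpan ℝ S := by
    have := Submodule.sub_starProjection_mem_orthogonal (K := (vectorSpan ℝ S)ᗮ) (a - s)
    rwa [Submodule.orthogonal_orthogonal] at this
  have hds : inner ℝ d (a - s) = inner ℝ d d := by
    have := hdperp _ hdiff
    rwa [inner_sub_right, sub_eq_zero] at this
  set W := vectorSpan ℝ (insert a S) with hW
  have hSW : vectorSpan ℝ S ≤ W := vectorSpan_mono ℝ (Set.subset_insert a S)
  have hdW : d ∈ W := by
    have h1 : a - s ∈ W := vsub_mem_vectorSpan ℝ (Set.mem_insert a S) (Set.mem_insert_of_mem a hs)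
    simpa using W.sub_mem h1 (hSW hdiff)
  -- The cone formula needs an ambient space of dimension `N + 1` and its apex at `0`, so everything
  -- is pulled back to `W` by the isometry `w ↦ w + a`. Seen from the apex, the base lies in
  -- direction `-d`.
  let v : W := ⟨-d, W.neg_mem hdW⟩
  have hv : v ≠ 0 := by
    intro h
    exact hd (neg_eq_zero.1 (congrArg Subtype.val h))
  let ι : W → V := fun w => (w : V) + a
  have hι : Isometry ι := by
    refine Isometry.of_dist_eq fun x y => ?_
    simp [ι, Subtype.dist_eq]
  have hhull : ∀ y ∈ convexHull ℝ S, y - a ∈ W ∧ inner ℝ (-d) (y - a) = inner ℝ d d := by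
    have hconv : Convex ℝ {y : V | y - a ∈ W ∧ inner ℝ (-d) (y - a) = inner ℝ d d} := by
      intro x hx y hy α β _ _ hαβ
      have he : α • x + β • y - a = α • (x - a) + β • (y - a) := by
        rw [smul_sub, smul_sub]
        have : a = α • a + β • a := by rw [← add_smul, hαβ, one_smul]
        nth_rewrite 1 [this]
        abel
      refine ⟨?_, ?_⟩
      · rw [he]
        exact W.add_mem (W.smul_mem _ hx.1) (W.smul_mem _ hy.1)
      · rw [he, inner_add_right, inner_smul_right, inner_smul_right, hx.2, hy.2, ← add_mul, hαβ,
          one_mul]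
    refine fun y hy => convexHull_min ?_ hconv hy
    intro y hy
    refine ⟨vsub_mem_vectorSpan ℝ (Set.mem_insert_of_mem a hy) (Set.mem_insert a S), ?_⟩
    have h1 := hdperp (y - s) (vsub_mem_vectorSpan ℝ hy hs)
    rw [show y - a = (y - s) - (a - s) by abel, inner_sub_right, inner_neg_left, inner_neg_left, h1,
      hds]
    simp
  have hbase : ι '' (ι ⁻¹' convexHull ℝ S) = convexHull ℝ S := by
    refine Set.image_preimage_eq_of_subset fun y hy => ?_
    exact ⟨⟨y - a, (hhull y hy).1⟩, by simp [ι]⟩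
  have hjoin : ∀ z, z ∈ convexHull ℝ (insert a S) ↔
      ∃ t ∈ Set.Icc (0 : ℝ) 1, ∃ y ∈ convexHull ℝ S, z = t • (y - a) + a := by
    intro z
    rw [convexHull_insert ⟨s, hs⟩, mem_convexJoin]
    simp only [Set.mem_singleton_iff, exists_eq_left, segment_eq_image', Set.mem_image]
    constructor
    · rintro ⟨y, hy, t, ht, rfl⟩
      exact ⟨t, ht, y, hy, add_comm _ _⟩
    · rintro ⟨t, ht, y, hy, rfl⟩
      exact ⟨y, hy, t, ht, add_comm _ _⟩
  have htop : ι '' (ι ⁻¹' convexHull ℝ (insert a S)) = convexHull ℝ (insert a S) := by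
    refine Set.image_preimage_eq_of_subset fun z hz => ?_
    obtain ⟨t, -, y, hy, rfl⟩ := (hjoin z).1 hz
    exact ⟨⟨t • (y - a), W.smul_mem _ (hhull y hy).1⟩, by simp [ι]⟩
  have hcone := euclideanHausdorffMeasure_cone hrank hv (T := ι ⁻¹' convexHull ℝ S)
    (K := ι ⁻¹' convexHull ℝ (insert a S)) ?_ ?_ ?_
  · rw [← htop, hι.euclideanHausdorffMeasure_image, hcone, ← hbase,
      hι.euclideanHausdorffMeasure_image, hbase, ENNReal.toReal_mul, ENNReal.toReal_mul,
      ENNReal.toReal_ofReal (by positivity), toReal_enorm]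
    have : ‖v‖ = ‖d‖ := by simp [v]
    rw [this]
    ring
  · intro y hy
    have := (hhull _ hy).2
    simp only [ι, add_sub_cancel_right] at this
    rw [Submodule.coe_inner, Submodule.coe_inner, this]
    simp [v]
  · exact ((hS.insert a).isCompact_convexHull (𝕜 := ℝ)).isClosed.measurableSet.preimage
      hι.continuous.measurable
  · intro z
    rw [Set.mem_preimage, hjoin]
    constructor
    · rintro ⟨t, ht, y, hy, h⟩
      refine ⟨t, ht, ⟨y - a, (hhull y hy).1⟩, by simpa [ι] using hy, ?_⟩
      ext
      simpa [ι] using h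
    · rintro ⟨t, ht, y, hy, rfl⟩
      exact ⟨t, ht, ι y, hy, by simp [ι]⟩

/-! ### Linear algebra of barycentric gradients, normals and angles -/

/-- Let `g a`, `a ∈ s`, be the gradients of the barycentric coordinates with respect to the points
`x a`, `a ∈ s`.  Then `∑ ⟪g a, g b⟫ ‖x a - x b‖ ^ 2` is `-2` times the dimension. -/
theorem sum_inner_gradient_mul_norm_sub_sq {ι V : Type*} [DecidableEq ι] [NormedAddCommGroup V]
    [InnerProductSpace ℝ V] {s : Finset ι} (hs : s.Nonempty) {x g : ι → V}
    (hspan : vectorSpan ℝ (x '' s) = ⊤)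
    (hg : ∀ a ∈ s, ∀ b ∈ s, ∀ c ∈ s, inner ℝ (g a) (x b - x c) =
      (if a = b then 1 else 0) - (if a = c then 1 else 0)) :
    ∑ a ∈ s, ∑ b ∈ s, inner ℝ (g a) (g b) * ‖x a - x b‖ ^ 2 = -2 * ((s.card : ℝ) - 1) := by
  -- Differences of the points span `V`, so an identity linear in `w` need only be checked on them.
  have hind : ∀ P : V → Prop, (∀ b ∈ s, ∀ c ∈ s, P (x b - x c)) → P 0 →
      (∀ u w, P u → P w → P (u + w)) → (∀ (r : ℝ) u, P u → P (r • u)) → ∀ w, P w := by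
    intro P h1 h0 hadd hsmul w
    have hw : w ∈ vectorSpan ℝ (x '' s) := hspan ▸ Submodule.mem_top
    rw [vectorSpan_def] at hw
    induction hw using Submodule.span_induction with
    | mem y hy =>
      obtain ⟨-, ⟨b, hb, rfl⟩, -, ⟨c, hc, rfl⟩, rfl⟩ := hy
      exact h1 b hb c hc
    | zero => exact h0
    | add u w _ _ hu hw => exact hadd u w hu hw
    | smul r u _ hu => exact hsmul r u hu
  -- `hsum` and `hrepr` differentiate the two rules for barycentric coordinates: they sum to `1`,
  -- and they reproduce the point.
  have hsum : ∀ w, ∑ a ∈ s, inner ℝ (g a) w = 0 := by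
    refine hind _ (fun b hb c hc => ?_) (by simp) ?_ ?_
    · rw [Finset.sum_congr rfl fun a ha => hg a ha b hb c hc]
      simp [Finset.sum_sub_distrib, hb, hc]
    · intro u w hu hw
      simp [inner_add_right, Finset.sum_add_distrib, hu, hw]
    · intro r u hu
      simp [inner_smul_right, ← Finset.mul_sum, hu]
  have hrepr : ∀ w, ∑ a ∈ s, inner ℝ (g a) w • x a = w := by
    refine hind _ (fun b hb c hc => ?_) (by simp) ?_ ?_
    · rw [Finset.sum_congr rfl fun a ha => by rw [hg a ha b hb c hc]]
      simp [Finset.sum_sub_distrib, sub_smul, hb, hc]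
    · intro u w hu hw
      simp [inner_add_right, add_smul, Finset.sum_add_distrib, hu, hw]
    · intro r u hu
      simp [inner_smul_right, mul_smul, ← Finset.smul_sum, hu]
  obtain ⟨c, hc⟩ := hs
  have htrace : ∑ b ∈ s, inner ℝ (g b) (x b) = (s.card : ℝ) - 1 := by
    calc ∑ b ∈ s, inner ℝ (g b) (x b)
        = ∑ b ∈ s, inner ℝ (g b) (x b - x c) + ∑ b ∈ s, inner ℝ (g b) (x c) := by
          rw [← Finset.sum_add_distrib]
          exact Finset.sum_congr rfl fun b _ => by rw [← inner_add_right, sub_add_cancel]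
      _ = (s.card : ℝ) - 1 := by
          rw [hsum, Finset.sum_congr rfl fun b hb => hg b hb b hb c hc]
          simp [Finset.sum_sub_distrib, hc]
  -- Expanding `g b` by `hrepr` turns the double sum into `htrace`.
  have hcross : ∑ a ∈ s, ∑ b ∈ s, inner ℝ (g a) (g b) * inner ℝ (x a) (x b) =
      (s.card : ℝ) - 1 := by
    rw [← htrace, Finset.sum_comm]
    refine Finset.sum_congr rfl fun b _ => ?_
    conv_rhs => rw [← hrepr (g b)]
    rw [sum_inner]
    simp_rw [real_inner_smul_left]
  have hleft : ∑ a ∈ s, ∑ b ∈ s, inner ℝ (g a) (g b) * ‖x b‖ ^ 2 = 0 := by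
    rw [Finset.sum_comm]
    simp_rw [← Finset.sum_mul, hsum]
    simp
  have hright : ∑ a ∈ s, ∑ b ∈ s, inner ℝ (g a) (g b) * ‖x a‖ ^ 2 = 0 := by
    refine Finset.sum_eq_zero fun a _ => ?_
    rw [← Finset.sum_mul, Finset.sum_congr rfl fun b _ => real_inner_comm (g b) (g a), hsum,
      zero_mul]
  calc ∑ a ∈ s, ∑ b ∈ s, inner ℝ (g a) (g b) * ‖x a - x b‖ ^ 2
      = ∑ a ∈ s, ∑ b ∈ s, (inner ℝ (g a) (g b) * ‖x a‖ ^ 2 + inner ℝ (g a) (g b) * ‖x b‖ ^ 2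
          - 2 * (inner ℝ (g a) (g b) * inner ℝ (x a) (x b))) := by
        refine Finset.sum_congr rfl fun a _ => Finset.sum_congr rfl fun b _ => ?_
        rw [norm_sub_sq_real]
        ring
    _ = -2 * ((s.card : ℝ) - 1) := by
        simp_rw [Finset.sum_sub_distrib, Finset.sum_add_distrib, ← Finset.mul_sum]
        rw [hleft, hright, hcross]
        ring

/-- The orthogonal complements of two vectors of a plane with respect to each other: the cotangent
of the supplement of the angle between them. -/
theorem cot_pi_sub_angle_of_sub_smul {V : Type*} [NormedAddCommGroup V] [InnerProductSpace ℝ V]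
    {p q u w : V} (hu : u = p - (inner ℝ p q / ‖q‖ ^ 2) • q)
    (hw : w = q - (inner ℝ q p / ‖p‖ ^ 2) • p) (hq : q ≠ 0) (hu0 : u ≠ 0) :
    Real.cot (Real.pi - InnerProductGeometry.angle u w) =
      - (‖u‖ * ‖q‖ * inner ℝ ((‖u‖ ^ 2)⁻¹ • u) ((‖w‖ ^ 2)⁻¹ • w)) := by
  have hB : 0 < ‖q‖ ^ 2 := by positivity
  have hU : 0 < ‖u‖ ^ 2 := by positivity
  -- The Gram determinant of `p`, `q` controls everything: `‖u‖²`, `‖w‖²` and `⟪u, w⟫` are all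
  -- multiples of it.
  have e1 : ‖u‖ ^ 2 * ‖q‖ ^ 2 = ‖p‖ ^ 2 * ‖q‖ ^ 2 - inner ℝ p q ^ 2 := by
    rw [hu, norm_sub_sq_real, norm_smul, inner_smul_right, mul_pow, Real.norm_eq_abs, sq_abs]
    field_simp
    ring
  have hD : 0 < ‖p‖ ^ 2 * ‖q‖ ^ 2 - inner ℝ p q ^ 2 := e1 ▸ mul_pos hU hB
  have hA : 0 < ‖p‖ ^ 2 := by
    by_contra h
    have : ‖p‖ ^ 2 = 0 := le_antisymm (not_lt.1 h) (sq_nonneg _)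
    rw [this] at hD
    nlinarith [sq_nonneg (inner ℝ p q : ℝ)]
  have hp : ‖p‖ ≠ 0 := by
    intro h
    simp [h] at hA
  have e2 : ‖w‖ ^ 2 * ‖p‖ ^ 2 = ‖p‖ ^ 2 * ‖q‖ ^ 2 - inner ℝ p q ^ 2 := by
    rw [hw, norm_sub_sq_real, norm_smul, inner_smul_right, mul_pow, Real.norm_eq_abs, sq_abs,
      real_inner_comm p q]
    field_simp
    ring
  have e3 : inner ℝ u w * (‖p‖ ^ 2 * ‖q‖ ^ 2) =
      - (inner ℝ p q * (‖p‖ ^ 2 * ‖q‖ ^ 2 - inner ℝ p q ^ 2)) := by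
    rw [hu, hw, inner_sub_left, inner_sub_right, inner_sub_right, real_inner_smul_left,
      real_inner_smul_left, inner_smul_right, inner_smul_right, real_inner_self_eq_norm_sq,
      real_inner_self_eq_norm_sq, real_inner_comm p q]
    field_simp
    ring
  have hW : 0 < ‖w‖ ^ 2 := by
    by_contra h
    have : ‖w‖ ^ 2 = 0 := le_antisymm (not_lt.1 h) (sq_nonneg _)
    rw [this] at e2
    linarith
  have hw0 : w ≠ 0 := by
    rintro rfl
    simp at hW
  -- This amounts to `sin (angle u w) = ‖w‖ / ‖q‖`: `w` is the part of `q` orthogonal to `p`, and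
  -- `u`, `w` enclose an angle supplementary to that of `p`, `q`.
  have hsqrt : Real.sqrt (inner ℝ u u * inner ℝ w w - inner ℝ u w * inner ℝ u w) =
      ‖u‖ ^ 2 * ‖w‖ ^ 2 / (‖u‖ * ‖q‖) := by
    rw [Real.sqrt_eq_iff_mul_self_eq_of_pos (by positivity), real_inner_self_eq_norm_sq,
      real_inner_self_eq_norm_sq]
    set A := ‖p‖ ^ 2
    set B := ‖q‖ ^ 2
    set U := ‖u‖ ^ 2
    set W := ‖w‖ ^ 2
    set c : ℝ := inner ℝ p q
    set i : ℝ := inner ℝ u w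
    have hsq : (‖u‖ * ‖q‖) * (‖u‖ * ‖q‖) = A * B - c ^ 2 := by
      rw [← e1]; simp only [U, B]; ring
    rw [div_mul_div_comm, hsq]
    have h1 : U = (A * B - c ^ 2) / B := by rw [← e1]; field_simp
    have h2 : W = (A * B - c ^ 2) / A := by rw [← e2]; field_simp
    have h3 : i = - (c * (A * B - c ^ 2)) / (A * B) := by rw [← e3]; field_simp
    rw [h1, h2, h3]
    field_simp
  have hcos := InnerProductGeometry.cos_angle_mul_norm_mul_norm u w
  have hsin := InnerProductGeometry.sin_angle_mul_norm_mul_norm u w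
  rw [hsqrt] at hsin
  have hu' : ‖u‖ ≠ 0 := norm_ne_zero_iff.2 hu0
  have hw' : ‖w‖ ≠ 0 := norm_ne_zero_iff.2 hw0
  have hq' : ‖q‖ ≠ 0 := norm_ne_zero_iff.2 hq
  rw [Real.cot_eq_cos_div_sin, Real.cos_pi_sub, Real.sin_pi_sub, real_inner_smul_left,
    inner_smul_right, neg_div]
  congr 1
  have hc' : Real.cos (InnerProductGeometry.angle u w) = inner ℝ u w / (‖u‖ * ‖w‖) := by
    rw [← hcos]; field_simp
  have hs' : Real.sin (InnerProductGeometry.angle u w) = ‖w‖ / ‖q‖ := by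
    rw [← mul_div_cancel_right₀ (Real.sin _) (mul_ne_zero hu' hw'), hsin]
    field_simp
  rw [hc', hs']
  field_simp

/-- Removing the component along one more point from an orthogonal projection. -/
theorem starProjection_orthogonal_vectorSpan_insert {V : Type*} [NormedAddCommGroup V]
    [InnerProductSpace ℝ V] [FiniteDimensional ℝ V] {T : Set V} {a b c : V} (hc : c ∈ T)
    (hb : (vectorSpan ℝ T)ᗮ.starProjection (b - c) ≠ 0) :
    (vectorSpan ℝ (insert b T))ᗮ.starProjection (a - b) =
      (vectorSpan ℝ T)ᗮ.starProjection (a - c) -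
        (inner ℝ ((vectorSpan ℝ T)ᗮ.starProjection (a - c))
          ((vectorSpan ℝ T)ᗮ.starProjection (b - c)) /
            ‖(vectorSpan ℝ T)ᗮ.starProjection (b - c)‖ ^ 2) •
          (vectorSpan ℝ T)ᗮ.starProjection (b - c) := by
  set K := vectorSpan ℝ T
  set U := vectorSpan ℝ (insert b T)
  set p := Kᗮ.starProjection (a - c) with hp
  set q := Kᗮ.starProjection (b - c) with hq
  have hKU : K ≤ U := vectorSpan_mono ℝ (Set.subset_insert b T)
  have hdiff : ∀ x, x - Kᗮ.starProjection x ∈ K := fun x => by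
    have := Submodule.sub_starProjection_mem_orthogonal (K := Kᗮ) x
    rwa [Submodule.orthogonal_orthogonal] at this
  have hbc : b - c ∈ U :=
    vsub_mem_vectorSpan ℝ (Set.mem_insert b T) (Set.mem_insert_of_mem b hc)
  have hqU : q ∈ U := by
    have := U.sub_mem hbc (hKU (hdiff (b - c)))
    rwa [sub_sub_cancel] at this
  have hpK : p ∈ Kᗮ := Submodule.starProjection_apply_mem _ _
  have hqK : q ∈ Kᗮ := Submodule.starProjection_apply_mem _ _
  have hqq : ‖q‖ ^ 2 ≠ 0 := by simpa using hb
  set r := inner ℝ p q / ‖q‖ ^ 2 with hr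
  have hrK : p - r • q ∈ Kᗮ := Kᗮ.sub_mem hpK (Kᗮ.smul_mem r hqK)
  -- The candidate is orthogonal to `U` and differs from `a - b` by an element of `U`.
  refine Submodule.eq_starProjection_of_mem_of_inner_eq_zero ?_ ?_
  · rw [Submodule.mem_orthogonal]
    intro y hy
    have hUs : U = Submodule.span ℝ ((· -ᵥ c) '' insert b T) :=
      vectorSpan_eq_span_vsub_set_right ℝ (Set.mem_insert_of_mem b hc)
    replace hy : y ∈ U := hy
    rw [hUs] at hy
    induction hy using Submodule.span_induction with
    | mem z hz =>
      obtain ⟨t, ht, rfl⟩ := hz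
      rcases Set.mem_insert_iff.1 ht with rfl | ht
      · have h1 : inner ℝ ((t - c) - q) (p - r • q) = 0 :=
          Submodule.inner_right_of_mem_orthogonal (hdiff (t - c)) hrK
        rw [inner_sub_left, sub_eq_zero] at h1
        refine h1.trans ?_
        rw [inner_sub_right, inner_smul_right, real_inner_self_eq_norm_sq, hr,
          div_mul_cancel₀ _ hqq, real_inner_comm, sub_self]
      · exact Submodule.inner_right_of_mem_orthogonal (vsub_mem_vectorSpan ℝ ht hc) hrK
    | zero => simp
    | add y z _ _ hy hz => rw [inner_add_left, hy, hz, add_zero]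
    | smul k y _ hy => rw [real_inner_smul_left, hy, mul_zero]
  · intro y hy
    refine Submodule.inner_right_of_mem_orthogonal (K := U) ?_ hy
    have : a - b - (p - r • q) = ((a - c) - p) - (b - c) + r • q := by abel
    rw [this]
    exact U.add_mem (U.sub_mem (hKU (hdiff (a - c))) hbc) (U.smul_mem r hqU)

/-! ### Heights, normals and the cotangent formula of a simplex -/

section SimplexGeometry

variable {n : ℕ} {f : EuclideanSpace ℝ (Fin n) → EuclideanSpace ℝ (Fin n)}
  {s t σ : Finset (EuclideanSpace ℝ (Fin n))} {a b c : EuclideanSpace ℝ (Fin n)}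

theorem affineIndependent_image_mono (h : AffineIndependent ℝ fun v : s => f v) (hts : t ⊆ s) :
    AffineIndependent ℝ fun v : t => f v :=
  h.comp_embedding ⟨fun v : t => (⟨v, hts v.2⟩ : s), fun _ _ hvw =>
    Subtype.ext (congrArg (fun u : s => u.1) hvw)⟩

theorem finrank_vectorSpan_image (h : AffineIndependent ℝ fun v : s => f v) {k : ℕ}
    (hcard : s.card = k + 1) : Module.finrank ℝ (vectorSpan ℝ (f '' s)) = k := by
  rw [Set.image_eq_range]
  exact h.finrank_vectorSpan (by rw [Fintype.card_coe, hcard])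

/-- Otherwise translating from `f b` would put `f a` in the affine span of the other points. This is
what makes all heights nonzero. -/
theorem sub_notMem_vectorSpan_image (h : AffineIndependent ℝ fun v : s => f v)
    (ha : a ∈ s) (hts : t ⊆ s) (hat : a ∉ t) (hb : b ∈ t) :
    f a - f b ∉ vectorSpan ℝ (f '' t) := by
  intro hmem
  have h1 : f a ∈ affineSpan ℝ (f '' t) := by
    have := AffineSubspace.vadd_mem_of_mem_direction
      ((direction_affineSpan ℝ (f '' (t : Set _))).symm ▸ hmem)
      (mem_affineSpan ℝ (Set.mem_image_of_mem f (Finset.mem_coe.2 hb)))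
    simpa using this
  have h2 : f '' t = (fun v : s => f v) '' {v | v.1 ∈ t} := by
    ext y
    constructor
    · rintro ⟨x, hx, rfl⟩
      exact ⟨⟨x, hts hx⟩, hx, rfl⟩
    · rintro ⟨x, hx, rfl⟩
      exact ⟨x, hx, rfl⟩
  rw [h2] at h1
  exact hat ((h.mem_affineSpan_iff ⟨a, ha⟩ _).1 h1)

theorem starProjection_image_ne_zero (h : AffineIndependent ℝ fun v : s => f v)
    (ha : a ∈ s) (hts : t ⊆ s) (hat : a ∉ t) (hb : b ∈ t) :
    (vectorSpan ℝ (f '' t))ᗮ.starProjection (f a - f b) ≠ 0 := by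
  intro h0
  have := Submodule.sub_starProjection_mem_orthogonal (K := (vectorSpan ℝ (f '' t))ᗮ) (f a - f b)
  rw [h0, sub_zero, Submodule.orthogonal_orthogonal] at this
  exact sub_notMem_vectorSpan_image h ha hts hat hb this

open Classical in
theorem image_eq_insert_image_erase (ha : a ∈ s) :
    f '' s = insert (f a) (f '' (s.erase a : Finset _)) := by
  rw [← Set.image_insert_eq, ← Finset.coe_insert, Finset.insert_erase ha]

/-- The volume of the convex hull of the image of the vertices. -/
noncomputable def hullVolume (k : ℕ) (f : EuclideanSpace ℝ (Fin n) → EuclideanSpace ℝ (Fin n))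
    (s : Finset (EuclideanSpace ℝ (Fin n))) : ℝ :=
  (μHE[k] (convexHull ℝ (f '' s))).toReal

open Classical in
theorem hullVolume_eq_height_mul (h : AffineIndependent ℝ fun v : s => f v) {k : ℕ}
    (hcard : s.card = k + 2) (ha : a ∈ s) (hb : b ∈ s.erase a) :
    hullVolume (k + 1) f s =
      ‖(vectorSpan ℝ (f '' (s.erase a : Finset _)))ᗮ.starProjection (f a - f b)‖ / (k + 1) *
        hullVolume k f (s.erase a) := by
  unfold hullVolume
  have hins := image_eq_insert_image_erase (f := f) ha
  rw [hins]
  refine euclideanHausdorffMeasure_convexHull_insert ((Finset.finite_toSet _).image f)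
    (Set.mem_image_of_mem f hb) ?_ ?_
  · rw [← hins]
    exact finrank_vectorSpan_image h hcard
  · exact starProjection_image_ne_zero h ha (Finset.erase_subset a s) (Finset.notMem_erase a s) hb

-- Leaving `U` free allows the span to be presented differently, for instance with an inserted
-- point.
open Classical in
theorem inwardNormal_eq_starProjection {U : Submodule ℝ (EuclideanSpace ℝ (Fin n))}
    (hU : U = vectorSpan ℝ (f '' (σ.erase a : Finset _))) :
    inwardNormal f σ a b = Uᗮ.starProjection (f a - f b) := by
  subst hU
  unfold inwardNormal
  congr!

theorem inwardNormal_ne_zero (h : AffineIndependent ℝ fun v : σ => f v)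
    (ha : a ∈ σ) (hb : b ∈ σ) (hab : b ≠ a) : inwardNormal f σ a b ≠ 0 := by
  classical
  unfold inwardNormal
  convert starProjection_image_ne_zero h ha (Finset.erase_subset a σ) (Finset.notMem_erase a σ)
    (Finset.mem_erase.2 ⟨hab, hb⟩)

open Classical in
theorem inner_inwardNormal_of_mem {w : EuclideanSpace ℝ (Fin n)}
    (hw : w ∈ vectorSpan ℝ (f '' (σ.erase a : Finset _))) : inner ℝ (inwardNormal f σ a b) w = 0 :=
  Submodule.inner_left_of_mem_orthogonal hw (by
    unfold inwardNormal
    convert Submodule.starProjection_apply_mem _ _)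

theorem inner_inwardNormal_sub_of_ne {x y : EuclideanSpace ℝ (Fin n)} (hx : x ∈ σ) (hy : y ∈ σ)
    (hxa : x ≠ a) (hya : y ≠ a) : inner ℝ (inwardNormal f σ a b) (f x - f y) = 0 := by
  classical
  exact inner_inwardNormal_of_mem (vsub_mem_vectorSpan ℝ
    (Set.mem_image_of_mem f (Finset.mem_coe.2 (Finset.mem_erase.2 ⟨hxa, hx⟩)))
    (Set.mem_image_of_mem f (Finset.mem_coe.2 (Finset.mem_erase.2 ⟨hya, hy⟩))))

/-- Together with `inner_inwardNormal_sub_of_ne`, this identifies a nonzero normal divided by its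
squared length as the gradient of the barycentric coordinate of `a`. -/
theorem inner_inwardNormal_self_sub (hb : b ∈ σ) (hba : b ≠ a) {x : EuclideanSpace ℝ (Fin n)}
    (hx : x ∈ σ) (hxa : x ≠ a) :
    inner ℝ (inwardNormal f σ a b) (f a - f x) = ‖inwardNormal f σ a b‖ ^ 2 := by
  classical
  have h1 : (f a - f b) - inwardNormal f σ a b ∈ vectorSpan ℝ (f '' (σ.erase a : Finset _)) := by
    have := Submodule.sub_starProjection_mem_orthogonal
      (K := (vectorSpan ℝ (f '' (σ.erase a : Finset _)))ᗮ) (f a - f b)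
    rw [Submodule.orthogonal_orthogonal] at this
    unfold inwardNormal
    convert this
  have h2 := inner_inwardNormal_of_mem (b := b) h1
  rw [inner_sub_right, sub_eq_zero, real_inner_self_eq_norm_sq] at h2
  rw [show f a - f x = (f a - f b) + (f b - f x) by abel, inner_add_right, h2,
    inner_inwardNormal_sub_of_ne hb hx hba hxa, add_zero]

/-- Changing the base vertex alters `f a - f b` by a direction of the opposite facet, which the
projection kills. -/
theorem inwardNormal_eq_of_ne (hb : b ∈ σ) (hba : b ≠ a) (hc : c ∈ σ) (hca : c ≠ a) :
    inwardNormal f σ a b = inwardNormal f σ a c := by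
  classical
  have h1 : f c - f b ∈ vectorSpan ℝ (f '' (σ.erase a : Finset _)) := vsub_mem_vectorSpan ℝ
    (Set.mem_image_of_mem f (Finset.mem_coe.2 (Finset.mem_erase.2 ⟨hca, hc⟩)))
    (Set.mem_image_of_mem f (Finset.mem_coe.2 (Finset.mem_erase.2 ⟨hba, hb⟩)))
  have h2 : (vectorSpan ℝ (f '' (σ.erase a : Finset _)))ᗮ.starProjection (f c - f b) = 0 :=
    (Submodule.starProjection_apply_eq_zero_iff _).2 (by
      rwa [Submodule.orthogonal_orthogonal])
  have h3 : inwardNormal f σ a b = (vectorSpan ℝ (f '' (σ.erase a : Finset _)))ᗮ.starProjection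
      ((f a - f c) + (f c - f b)) := by
    rw [sub_add_sub_cancel]
    exact inwardNormal_eq_starProjection rfl
  rw [h3, map_add, h2, add_zero]
  exact (inwardNormal_eq_starProjection rfl).symm

open Classical in
/-- The cotangent weight of an edge of a simplex, in terms of the gradients of the barycentric
coordinates of its two end points. -/
theorem hullVolume_mul_cot_dihedralAngle (h : AffineIndependent ℝ fun v : σ => f v) {k : ℕ}
    (hcard : σ.card = k + 3) (ha : a ∈ σ) (hb : b ∈ σ) (hba : b ≠ a) :
    hullVolume k f ((σ.erase a).erase b) * Real.cot (dihedralAngle f σ a b) =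
      - ((k + 2) * (k + 1) * hullVolume (k + 2) f σ *
        inner ℝ ((‖inwardNormal f σ a b‖ ^ 2)⁻¹ • inwardNormal f σ a b)
          ((‖inwardNormal f σ b a‖ ^ 2)⁻¹ • inwardNormal f σ b a)) := by
  have hbe : b ∈ σ.erase a := Finset.mem_erase.2 ⟨hba, hb⟩
  have hae : a ∈ σ.erase b := Finset.mem_erase.2 ⟨hba.symm, ha⟩
  have hc1 : (σ.erase a).card = k + 2 := by rw [Finset.card_erase_of_mem ha, hcard]; rfl
  have hc2 : ((σ.erase a).erase b).card = k + 1 := by rw [Finset.card_erase_of_mem hbe, hc1]; rfl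
  obtain ⟨c, hc⟩ : ((σ.erase a).erase b).Nonempty := by
    rw [← Finset.card_pos, hc2]; omega
  have hτσ : (σ.erase a).erase b ⊆ σ := (Finset.erase_subset _ _).trans (Finset.erase_subset _ _)
  have haτ : a ∉ (σ.erase a).erase b := by simp
  have hbτ : b ∉ (σ.erase a).erase b := by simp
  set T : Set (EuclideanSpace ℝ (Fin n)) := f '' ((σ.erase a).erase b : Finset _) with hT
  have hcT : f c ∈ T := Set.mem_image_of_mem f hc
  -- Modulo the directions of the face opposite to the edge, the simplex becomes a triangle with
  -- sides `p`, `q` from `f c`; each normal is one side minus its component along the other.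
  have hq := starProjection_image_ne_zero h hb hτσ hbτ hc
  have hp := starProjection_image_ne_zero h ha hτσ haτ hc
  have hN : inwardNormal f σ a b = (vectorSpan ℝ (insert (f b) T))ᗮ.starProjection (f a - f b) := by
    exact inwardNormal_eq_starProjection (by rw [hT, ← image_eq_insert_image_erase hbe])
  have hN' : inwardNormal f σ b a = (vectorSpan ℝ (insert (f a) T))ᗮ.starProjection (f b - f a) := by
    exact inwardNormal_eq_starProjection (by
      rw [hT, Finset.erase_right_comm, ← image_eq_insert_image_erase hae])
  have hcot := cot_pi_sub_angle_of_sub_smul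
    (hN.trans (starProjection_orthogonal_vectorSpan_insert hcT hq))
    (hN'.trans (starProjection_orthogonal_vectorSpan_insert hcT hp)) hq
    (inwardNormal_ne_zero h ha hb hba)
  -- Two pyramid steps, adding `b` to the opposite face and then `a`, give `(k + 2)(k + 1)` times
  -- the volume as the product of both heights and the face volume; these heights are the `‖u‖ *
  -- ‖q‖` in `hcot`.
  have hv1 := hullVolume_eq_height_mul (k := k + 1) h hcard ha hbe
  have hv2 := hullVolume_eq_height_mul (k := k)
    (affineIndependent_image_mono h (Finset.erase_subset a σ)) hc1 hbe hc
  have hN1 : (vectorSpan ℝ (f '' (σ.erase a : Finset _)))ᗮ.starProjection (f a - f b) =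
      inwardNormal f σ a b := (inwardNormal_eq_starProjection rfl).symm
  rw [hN1] at hv1
  rw [← hT] at hv2
  unfold dihedralAngle
  rw [hcot, hv1, hv2]
  push_cast
  field_simp
  ring

open Classical in
/-- The cotangent formula for the volume of a simplex. -/
theorem sum_hullVolume_mul_cot_mul_norm_sub_sq (h : AffineIndependent ℝ fun v : σ => f v) {k : ℕ}
    (hn : n = k + 2) (hcard : σ.card = n + 1) :
    ∑ a ∈ σ, ∑ b ∈ σ.erase a, hullVolume (n - 2) f ((σ.erase a).erase b) *
      Real.cot (dihedralAngle f σ a b) * ‖f a - f b‖ ^ 2 =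
        2 * (n : ℝ) ^ 2 * ((n : ℝ) - 1) * hullVolume n f σ := by
  have hcard' : σ.card = k + 3 := by omega
  have hk : n - 2 = k := by omega
  have hne : ∀ a ∈ σ, ∃ b ∈ σ, b ≠ a := fun a ha => by
    obtain ⟨b, hb⟩ : (σ.erase a).Nonempty := by
      rw [← Finset.card_pos, Finset.card_erase_of_mem ha]; omega
    exact ⟨b, Finset.mem_of_mem_erase hb, Finset.ne_of_mem_erase hb⟩
  -- Any base vertex yields the same normal, so `g a` depends on `a` alone.
  choose! β hβ hβa using hne
  set g := fun a => (‖inwardNormal f σ a (β a)‖ ^ 2)⁻¹ • inwardNormal f σ a (β a) with hg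
  have hgb : ∀ a ∈ σ, ∀ b ∈ σ, b ≠ a →
      (‖inwardNormal f σ a b‖ ^ 2)⁻¹ • inwardNormal f σ a b = g a := fun a ha b hb hba => by
    rw [inwardNormal_eq_of_ne hb hba (hβ a ha) (hβa a ha)]
  have hspan : vectorSpan ℝ (f '' σ) = ⊤ :=
    Submodule.eq_top_of_finrank_eq (by rw [finrank_vectorSpan_image h hcard]; simp)
  have hnorm : ∀ a ∈ σ, (‖inwardNormal f σ a (β a)‖ ^ 2) ≠ 0 := fun a ha =>
    pow_ne_zero 2 (norm_ne_zero_iff.2 (inwardNormal_ne_zero h ha (hβ a ha) (hβa a ha)))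
  have hsum := sum_inner_gradient_mul_norm_sub_sq (s := σ) (x := f) (g := g)
    (Finset.card_pos.1 (by omega)) hspan (by
      intro a ha b hb c hc
      simp only [hg, real_inner_smul_left]
      by_cases hab : a = b
      · subst hab
        by_cases hac : a = c
        · subst hac
          simp
        · rw [inner_inwardNormal_self_sub (hβ a ha) (hβa a ha) hc (Ne.symm hac),
            inv_mul_cancel₀ (hnorm a ha)]
          simp [hac]
      · by_cases hac : a = c
        · subst hac
          rw [← neg_sub, inner_neg_right,
            inner_inwardNormal_self_sub (hβ a ha) (hβa a ha) hb (Ne.symm hab), mul_neg,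
            inv_mul_cancel₀ (hnorm a ha)]
          simp [hab]
        · rw [inner_inwardNormal_sub_of_ne hb hc (Ne.symm hab) (Ne.symm hac)]
          simp [hab, hac])
  have hterm : ∀ a ∈ σ, ∀ b ∈ σ.erase a, hullVolume (n - 2) f ((σ.erase a).erase b) *
      Real.cot (dihedralAngle f σ a b) * ‖f a - f b‖ ^ 2 =
        -((k + 2) * (k + 1) * hullVolume n f σ) * (inner ℝ (g a) (g b) * ‖f a - f b‖ ^ 2) := by
    intro a ha b hb
    have hba := Finset.ne_of_mem_erase hb
    have hb' := Finset.mem_of_mem_erase hb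
    rw [hk, hullVolume_mul_cot_dihedralAngle h hcard' ha hb' hba, hgb a ha b hb' hba,
      hgb b hb' a ha hba.symm, ← hn]
    ring
  have herase : ∀ a ∈ σ, ∑ b ∈ σ.erase a, inner ℝ (g a) (g b) * ‖f a - f b‖ ^ 2 =
      ∑ b ∈ σ, inner ℝ (g a) (g b) * ‖f a - f b‖ ^ 2 := fun a ha =>
    Finset.sum_erase σ (by simp)
  rw [Finset.sum_congr rfl fun a ha => Finset.sum_congr rfl (hterm a ha)]
  simp_rw [← Finset.mul_sum]
  rw [Finset.sum_congr rfl herase, hsum, hcard]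
  have : (n : ℝ) = k + 2 := by rw [hn]; push_cast; rfl
  push_cast
  rw [this]
  ring

theorem hullVolume_pos (h : AffineIndependent ℝ fun v : σ => f v) (hcard : σ.card = n + 1) :
    0 < hullVolume n f σ := by
  have hspan : vectorSpan ℝ (f '' σ) = ⊤ :=
    Submodule.eq_top_of_finrank_eq (by rw [finrank_vectorSpan_image h hcard]; simp)
  obtain ⟨v, hv⟩ : σ.Nonempty := Finset.card_pos.1 (by omega)
  have hne : (f '' (σ : Set (EuclideanSpace ℝ (Fin n)))).Nonempty := ⟨f v, v, hv, rfl⟩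
  have hint : (interior (convexHull ℝ (f '' (σ : Set (EuclideanSpace ℝ (Fin n)))))).Nonempty := by
    rw [interior_convexHull_nonempty_iff_affineSpan_eq_top,
      AffineSubspace.affineSpan_eq_top_iff_vectorSpan_eq_top_of_nonempty ℝ _ _ hne]
    exact hspan
  unfold hullVolume
  rw [EuclideanSpace.euclideanHausdorffMeasure_eq_volume]
  exact ENNReal.toReal_pos (MeasureTheory.Measure.measure_pos_of_nonempty_interior _ hint).ne'
    (((Finset.finite_toSet σ).image f).isCompact_convexHull (𝕜 := ℝ)).measure_lt_top.ne

end SimplexGeometry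

/-! ### Graph Laplacian and weighted variance -/

/-- The quadratic form of a weighted graph Laplacian. -/
theorem sum_sum_laplacian_mul_inner {ι V : Type*} [Fintype ι] [DecidableEq ι]
    [NormedAddCommGroup V] [InnerProductSpace ℝ V] (w : ι → ι → ℝ) (hw : ∀ a b, w a b = w b a)
    (x : ι → V) :
    ∑ a, ∑ b, (if a = b then ∑ c ∈ Finset.univ.erase a, w a c else - w a b) * inner ℝ (x a) (x b) =
      1 / 2 * ∑ a, ∑ b ∈ Finset.univ.erase a, w a b * ‖x a - x b‖ ^ 2 := by
  have hrow : ∀ a, ∑ b, (if a = b then ∑ c ∈ Finset.univ.erase a, w a c else - w a b) *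
      inner ℝ (x a) (x b) =
      ∑ b ∈ Finset.univ.erase a, w a b * (‖x a‖ ^ 2 - inner ℝ (x a) (x b)) := by
    intro a
    rw [← Finset.add_sum_erase _ _ (Finset.mem_univ a), if_pos rfl, real_inner_self_eq_norm_sq,
      Finset.sum_mul, ← Finset.sum_add_distrib]
    refine Finset.sum_congr rfl fun b hb => ?_
    rw [if_neg (Finset.ne_of_mem_erase hb).symm]
    ring
  have hsymm : ∑ a, ∑ b ∈ Finset.univ.erase a, w a b * ‖x b‖ ^ 2 =
      ∑ a, ∑ b ∈ Finset.univ.erase a, w a b * ‖x a‖ ^ 2 := by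
    rw [Finset.sum_comm' (t' := Finset.univ) (s' := fun b => Finset.univ.erase b)]
    · exact Finset.sum_congr rfl fun a _ => Finset.sum_congr rfl fun b _ => by rw [hw]
    · intro a b
      simp [ne_comm]
  have hexp : ∑ a, ∑ b ∈ Finset.univ.erase a, w a b * ‖x a - x b‖ ^ 2 =
      ∑ a, ∑ b ∈ Finset.univ.erase a, w a b * ‖x a‖ ^ 2 +
      ∑ a, ∑ b ∈ Finset.univ.erase a, w a b * ‖x b‖ ^ 2 -
      2 * ∑ a, ∑ b ∈ Finset.univ.erase a, w a b * inner ℝ (x a) (x b) := by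
    simp_rw [Finset.mul_sum, ← Finset.sum_add_distrib, ← Finset.sum_sub_distrib]
    refine Finset.sum_congr rfl fun a _ => Finset.sum_congr rfl fun b _ => ?_
    rw [norm_sub_sq_real]
    ring
  rw [hexp, hsymm, Finset.sum_congr rfl fun a _ => hrow a]
  simp_rw [mul_sub, Finset.sum_sub_distrib]
  ring

/-- The weighted variance of the ratios `v / m` between its smallest and largest weight. -/
theorem sum_sq_div_sub_sq_div {ι : Type*} {s : Finset ι} {v m : ι → ℝ} (hm : ∀ i ∈ s, 0 < m i)
    (hv : ∑ i ∈ s, v i ≠ 0) :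
    ∑ i ∈ s, v i ^ 2 / m i - (∑ i ∈ s, v i) ^ 2 / ∑ i ∈ s, m i =
      ∑ i ∈ s, m i * (((∑ i ∈ s, v i) ^ 2 / (∑ i ∈ s, m i) ^ 2) *
        ((v i / ∑ i ∈ s, v i) / (m i / ∑ i ∈ s, m i) - 1) ^ 2) := by
  have hs : s.Nonempty := by
    rw [Finset.nonempty_iff_ne_empty]
    rintro rfl
    simp at hv
  have hT : 0 < ∑ i ∈ s, m i := Finset.sum_pos hm hs
  set C := ∑ i ∈ s, v i with hC
  set T := ∑ i ∈ s, m i with hTdef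
  -- Each term is `m i * (v i / m i - C / T) ^ 2`, expanded so that the last two summands add up to
  -- `-C ^ 2 / T`.
  have hterm : ∀ i ∈ s, m i * ((C ^ 2 / T ^ 2) * ((v i / C) / (m i / T) - 1) ^ 2) =
      v i ^ 2 / m i - 2 * (C / T) * v i + (C / T) ^ 2 * m i := by
    intro i hi
    have := (hm i hi).ne'
    field_simp
    ring
  rw [Finset.sum_congr rfl hterm, Finset.sum_add_distrib, Finset.sum_sub_distrib,
    ← Finset.mul_sum, ← Finset.mul_sum, ← hC, ← hTdef]
  field_simp
  ring

/-! ### Closed form of the stretch energy -/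

namespace DiscreteManifold

variable {n : ℕ} {M : DiscreteManifold n} {ρ : Finset (EuclideanSpace ℝ (Fin n)) → ℝ}
  {f : EuclideanSpace ℝ (Fin n) → EuclideanSpace ℝ (Fin n)}
  {σ τ : Finset (EuclideanSpace ℝ (Fin n))} {a b : EuclideanSpace ℝ (Fin n)}

theorem mem_simplices : σ ∈ M.simplices ↔ σ ∈ M.faces ∧ σ.card = n + 1 := by
  simp [simplices]

theorem mem_vertexSet_of_mem_simplices (hσ : σ ∈ M.simplices) (ha : a ∈ σ) :
    a ∈ M.vertexSet := by
  have : ({a} : Finset _) ∈ M.faces :=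
    M.down_closed (mem_simplices.1 hσ).1 (by simpa using ha) (by simp)
  simpa [vertexSet, Geometry.SimplicialComplex.vertices] using this

theorem OrientationPreserving.affineIndependent (hf : M.OrientationPreserving f)
    (hσ : σ ∈ M.simplices) : AffineIndependent ℝ fun v : σ => f v := by
  obtain ⟨A, hA, hdet⟩ := hf σ hσ
  have hinj : Function.Injective A := by
    rw [← AffineMap.linear_injective_iff]
    exact (LinearMap.equivOfDetNeZero A.linear hdet.ne').injective
  have h1 := (M.indep (mem_simplices.1 hσ).1).map' A hinj
  convert h1 using 1
  funext v
  exact hA (subset_convexHull ℝ _ v.2)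

/-- On `σ` the map agrees with an affine map, and affine maps commute with convex hulls; the
geometry then involves only the images of vertices. -/
theorem imageVolume_eq_hullVolume (hf : M.OrientationPreserving f) (hσ : σ ∈ M.simplices)
    (hτ : τ ⊆ σ) (k : ℕ) : imageVolume k f τ = hullVolume k f τ := by
  obtain ⟨A, hA, -⟩ := hf σ hσ
  unfold imageVolume hullVolume
  have h1 : convexHull ℝ (τ : Set (EuclideanSpace ℝ (Fin n))) ⊆ convexHull ℝ σ :=
    convexHull_mono (Finset.coe_subset.2 hτ)
  rw [(hA.mono h1).image_eq, (hA.mono ((subset_convexHull ℝ _).trans h1)).image_eq,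
    AffineMap.image_convexHull]

/-- Makes positivity of `|σ|` the case `f = id` of positivity of `|f(σ)|`. -/
theorem orientationPreserving_id : M.OrientationPreserving id := fun _ _ =>
  ⟨AffineMap.id ℝ _, fun _ _ => rfl, by simp⟩

theorem imageVolume_pos (hf : M.OrientationPreserving f) (hσ : σ ∈ M.simplices) :
    0 < imageVolume n f σ := by
  rw [imageVolume_eq_hullVolume hf hσ subset_rfl]
  exact hullVolume_pos (hf.affineIndependent hσ) (mem_simplices.1 hσ).2

theorem mass_pos (hρ : ∀ σ ∈ M.simplices, 0 < ρ σ) (hσ : σ ∈ M.simplices) : 0 < mass ρ σ :=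
  mul_pos (hρ σ hσ) (imageVolume_pos orientationPreserving_id hσ)

theorem weight_comm : M.weight ρ f a b = M.weight ρ f b a := by
  unfold weight
  congr 1
  refine Finset.sum_congr (by simp only [and_comm]) fun σ _ => ?_
  rw [Finset.erase_right_comm, dihedralAngle, dihedralAngle, InnerProductGeometry.angle_comm]

/-- No simplex contains a non-edge, so the case distinction in the Laplacian may be dropped. -/
theorem weight_eq_zero (h : ({a, b} : Finset (EuclideanSpace ℝ (Fin n))) ∉ M.faces) :
    M.weight ρ f a b = 0 := by
  unfold weight
  rw [Finset.sum_eq_zero, mul_zero]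
  intro σ hσ
  rw [Finset.mem_filter] at hσ
  exact absurd (M.down_closed (mem_simplices.1 hσ.1).1
    (by simp [Finset.insert_subset_iff, hσ.2]) (by simp)) h

-- In `1 / (2 * n)`, the `1 / n` is that of the energy and the `1 / 2` accounts for ordered pairs.
open Classical in
theorem stretchEnergy_eq_sum_weight : M.stretchEnergy ρ f = 1 / (2 * n) *
    ∑ a ∈ M.vertexSet, ∑ b ∈ M.vertexSet.erase a, M.weight ρ f a b * ‖f a - f b‖ ^ 2 := by
  have h1 : Matrix.trace ((M.vertexMatrix f).transpose * M.stretchLaplacian ρ f *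
      M.vertexMatrix f) = ∑ a : M.vertexSet, ∑ b : M.vertexSet,
        M.stretchLaplacian ρ f a b * inner ℝ (f a) (f b) := by
    rw [Matrix.mul_assoc, Matrix.trace_mul_comm, Matrix.mul_assoc, Matrix.trace]
    refine Finset.sum_congr rfl fun a _ => ?_
    rw [Matrix.diag_apply, Matrix.mul_apply]
    refine Finset.sum_congr rfl fun b _ => ?_
    simp [Matrix.mul_apply, vertexMatrix, PiLp.inner_apply]
  have h2 : ∀ a b : M.vertexSet, M.stretchLaplacian ρ f a b =
      if a = b then ∑ c ∈ Finset.univ.erase a, M.weight ρ f a c else - M.weight ρ f a b := by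
    intro a b
    unfold stretchLaplacian
    rw [Matrix.of_apply]
    split_ifs with h₁ h₂
    · congr!
    · rfl
    · rw [weight_eq_zero h₂, neg_zero]
  unfold stretchEnergy
  rw [h1]
  simp_rw [h2]
  rw [sum_sum_laplacian_mul_inner (fun a b : M.vertexSet => M.weight ρ f a b)
    (fun a b => weight_comm) (fun a => f a), ← mul_assoc, one_div_mul_one_div, mul_comm (n : ℝ) 2]
  congr 1
  rw [← Finset.sum_coe_sort M.vertexSet]
  refine Finset.sum_congr rfl fun a _ => ?_
  refine Finset.sum_bij (fun b _ => b.1) ?_ ?_ ?_ ?_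
  · intro b hb
    exact Finset.mem_erase.2 ⟨fun h => Finset.ne_of_mem_erase hb (Subtype.ext h), b.2⟩
  · intro b _ c _ h
    exact Subtype.ext h
  · intro b hb
    exact ⟨⟨b, Finset.mem_of_mem_erase hb⟩, Finset.mem_erase.2
      ⟨fun h => Finset.ne_of_mem_erase hb (congrArg Subtype.val h), Finset.mem_univ _⟩, rfl⟩
  · intro b _
    rfl

open Classical in
theorem stretchEnergy_eq_sum_sq_div_mass (hn : 2 ≤ n) (hf : M.OrientationPreserving f) :
    M.stretchEnergy ρ f = ∑ σ ∈ M.simplices, imageVolume n f σ ^ 2 / mass ρ σ := by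
  have hn0 : (n : ℝ) ≠ 0 := by positivity
  have hn1 : (n : ℝ) - 1 ≠ 0 := by
    have : (2 : ℝ) ≤ n := by exact_mod_cast hn
    linarith
  rw [stretchEnergy_eq_sum_weight]
  -- Indicators replace the filtered sum, whose range depends on `a` and `b`, so that the sum over
  -- simplices can be moved outside.
  have hweight : ∀ a b, M.weight ρ f a b * ‖f a - f b‖ ^ 2 = ∑ σ ∈ M.simplices,
      if a ∈ σ ∧ b ∈ σ then 1 / (n * ((n : ℝ) - 1)) * (imageVolume n f σ / mass ρ σ) *
        (hullVolume (n - 2) f ((σ.erase a).erase b) * Real.cot (dihedralAngle f σ a b) *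
          ‖f a - f b‖ ^ 2) else 0 := by
    intro a b
    rw [← Finset.sum_filter, weight, Finset.mul_sum, Finset.sum_mul]
    refine Finset.sum_congr (by congr!) fun σ hσ => ?_
    have hσ' := (Finset.mem_filter.1 hσ).1
    rw [stretchFactor, div_div_eq_mul_div,
      imageVolume_eq_hullVolume (τ := (σ.erase a).erase b) hf hσ'
        ((Finset.erase_subset _ _).trans (Finset.erase_subset _ _))]
    ring
  simp_rw [hweight]
  rw [Finset.sum_congr rfl fun a _ => Finset.sum_comm, Finset.sum_comm, Finset.mul_sum]
  refine Finset.sum_congr rfl fun σ hσ => ?_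
  have hsub : σ ⊆ M.vertexSet := fun a ha => mem_vertexSet_of_mem_simplices hσ ha
  have key := sum_hullVolume_mul_cot_mul_norm_sub_sq (hf.affineIndependent hσ) (k := n - 2)
    (by omega) (mem_simplices.1 hσ).2
  have hrestrict : ∀ F : EuclideanSpace ℝ (Fin n) → EuclideanSpace ℝ (Fin n) → ℝ,
      ∑ a ∈ M.vertexSet, ∑ b ∈ M.vertexSet.erase a, (if a ∈ σ ∧ b ∈ σ then F a b else 0) =
        ∑ a ∈ σ, ∑ b ∈ σ.erase a, F a b := by
    intro F
    rw [← Finset.sum_subset hsub]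
    · refine Finset.sum_congr rfl fun a ha => ?_
      rw [← Finset.sum_subset (Finset.erase_subset_erase a hsub)]
      · refine Finset.sum_congr rfl fun b hb => ?_
        rw [if_pos ⟨ha, Finset.mem_of_mem_erase hb⟩]
      · intro b hb hb'
        refine if_neg fun h => hb' (Finset.mem_erase.2 ⟨Finset.ne_of_mem_erase hb, h.2⟩)
    · intro a _ ha
      exact Finset.sum_eq_zero fun b _ => if_neg fun h => ha h.1
  rw [hrestrict]
  simp_rw [← Finset.mul_sum]
  rw [key, ← imageVolume_eq_hullVolume hf hσ subset_rfl]
  field_simp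

end DiscreteManifold

/-! ### The two-sided estimate -/

theorem mainTheorem6 {n : ℕ} (hn : 2 ≤ n) (M : DiscreteManifold n)
    (ρ : Finset (EuclideanSpace ℝ (Fin n)) → ℝ) (hρ : ∀ σ ∈ M.simplices, 0 < ρ σ)
    (f : EuclideanSpace ℝ (Fin n) → EuclideanSpace ℝ (Fin n))
    (hball : Set.MapsTo f M.space (Metric.closedBall 0 1))
    (haff : M.PiecewiseAffine f) (horient : M.OrientationPreserving f)
    (hbdry : ∀ v, M.IsBoundaryVertex v → f v ∈ Metric.sphere (0 : EuclideanSpace ℝ (Fin n)) 1)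
    (C : ℝ) (hC : ∑ σ ∈ M.simplices, imageVolume n f σ = C)
    (ε : ℝ) (hε : ε = M.stretchEnergy ρ f - C ^ 2 / M.totalMass ρ) :
    M.minMass ρ * (C ^ 2 / M.totalMass ρ ^ 2) * ‖M.relativeError ρ f‖ ^ 2 ≤ ε ∧
      ε ≤ M.maxMass ρ * (C ^ 2 / M.totalMass ρ ^ 2) * ‖M.relativeError ρ f‖ ^ 2 := by
  have hCpos : 0 < ∑ σ ∈ M.simplices, imageVolume n f σ :=
    Finset.sum_pos (fun σ hσ => DiscreteManifold.imageVolume_pos horient hσ) M.simplices_nonempty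
  have hnorm : ‖M.relativeError ρ f‖ ^ 2 = ∑ σ ∈ M.simplices,
      ((imageVolume n f σ / C) / (DiscreteManifold.mass ρ σ / M.totalMass ρ) - 1) ^ 2 := by
    rw [EuclideanSpace.real_norm_sq_eq, ← Finset.sum_coe_sort M.simplices, ← hC]
    rfl
  rw [DiscreteManifold.stretchEnergy_eq_sum_sq_div_mass hn horient, ← hC,
    DiscreteManifold.totalMass, sum_sq_div_sub_sq_div
      (fun σ hσ => DiscreteManifold.mass_pos hρ hσ) hCpos.ne'] at hε
  rw [hε, hnorm, mul_assoc, mul_assoc, Finset.mul_sum, Finset.mul_sum, Finset.mul_sum,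
    ← hC, DiscreteManifold.totalMass]
  -- Both bounds now compare sums with the same nonnegative factors, differing only in the weight of
  -- each simplex.
  constructor
  · exact Finset.sum_le_sum fun σ hσ => mul_le_mul_of_nonneg_right
      (Finset.inf'_le _ hσ) (by positivity)
  · exact Finset.sum_le_sum fun σ hσ => mul_le_mul_of_nonneg_right
      (Finset.le_sup' _ hσ) (by positivity)
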